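/- Let INF be intuitionistic NF set theory: the first-order theory with equality in the language $\{\in\}$, with intuitionistic logic, whose axioms are extensionality and stratified comprehension (for every stratified formula $\varphi$, the universal closure of $\exists y\,\forall x\,(x\in y\leftrightarrow\varphi)$ with $y$ not free in $\varphi$). A formula is stratified if its variables can be given non-negative integer indices such that $y$ gets one more than $x$ in each subformula $x\in y$, and $x,y$ get equal indices in each $x=y$. In INF, use the following definitions. $\Lambda$ is the empty set and $\langle x,y\rangle=\{\{x\},\{x,y\}\}$. A set $X$ is finite if it belongs to every $W$ such that $\Lambda\in W$ and $u\cup\{z\}\in W$ whenever $u\in W$ and $z\notin u$. $f:X\to Y$ means that for every $x\in X$ there is a unique $y$ with $\langle x,y\rangle\in f$, and this $y$ is in $Y$. $dom(f)\subseteq X$ means $\forall x,y\,(\langle x,y\rangle\in f\to x\in X)$. $f:X\to Y$ is onto if $\forall y\in Y\,\exists x\in X\,\langle x,y\rangle\in f$. $f$ is one-to-one (from $X$ to $Y$) if $f:X\to Y$, and $\langle x,y\rangle\in f\land\langle u,y\rangle\in f\to x=u$ for all $x,u,y$, and $y\in Y\land\langle x,y\rangle\in f\to x\in X$ for all $x,y$.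 $x\sim y$ means that there is an $f:x\to y$ that is one-to-one and onto; $Nc(x)=\{u:u\sim x\}$; and $\kappa\le\mu$ means that there are $a\in\kappa$ and $b\in\mu$ with $a\subseteq b$ and $b=a\cup(b-a)$. **Theorem.** INF proves both of the following. 1. For all $X$ and $f$: if $X$ is finite and $f:X\to X$ is onto with $dom(f)\subseteq X$, then $f$ is one-to-one. 2. For all $X$, $Y$ and $f$: if $X$ and $Y$ are finite, $Nc(X)\le Nc(Y)$, and $f:X\to Y$ is onto with $dom(f)\subseteq X$, then $f$ is one-to-one. -/

import Mathlib

namespace INF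

/-! ### First-order formulas over the language with `∈` and `=`

Formulas are written with de Bruijn indices: a variable is a natural number, and under a quantifier
the variable `0` is the bound one while the outer variable `i` is referred to as `i + 1`.  There are
no function symbols, so the only terms are variables. -/

inductive Fml : Type
  | mem : ℕ → ℕ → Fml
  | eq : ℕ → ℕ → Fml
  | bot : Fml
  | and : Fml → Fml → Fml
  | or : Fml → Fml → Fml
  | imp : Fml → Fml → Fml
  | all : Fml → Fml
  | ex : Fml → Fml

infix:70 " ∈ᵢ " => Fml.mem
infix:70 " =ᵢ " => Fml.eq
infixr:60 " ∧ᵢ " => Fml.and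
infixr:55 " ∨ᵢ " => Fml.or
infixr:50 " →ᵢ " => Fml.imp
prefix:65 "∀ᵢ " => Fml.all
prefix:65 "∃ᵢ " => Fml.ex

namespace Fml

def neg (φ : Fml) : Fml := φ →ᵢ bot

def iff (φ ψ : Fml) : Fml := (φ →ᵢ ψ) ∧ᵢ (ψ →ᵢ φ)

/-- Extension of a map on variables to the scope of one more quantifier. -/
def lift (ρ : ℕ → ℕ) : ℕ → ℕ
  | 0 => 0
  | i + 1 => ρ i + 1

/-- Capture-free simultaneous substitution of variables for the free variables. -/
def rename : (ℕ → ℕ) → Fml → Fml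
  | ρ, mem i j => ρ i ∈ᵢ ρ j
  | ρ, eq i j => ρ i =ᵢ ρ j
  | _, bot => bot
  | ρ, and φ ψ => rename ρ φ ∧ᵢ rename ρ ψ
  | ρ, or φ ψ => rename ρ φ ∨ᵢ rename ρ ψ
  | ρ, imp φ ψ => rename ρ φ →ᵢ rename ρ ψ
  | ρ, all φ => ∀ᵢ (rename (lift ρ) φ)
  | ρ, ex φ => ∃ᵢ (rename (lift ρ) φ)

/-- The formula seen from under one more (vacuous) quantifier. -/
def shift (φ : Fml) : Fml := rename Nat.succ φ

/-- `i :: σ`, the assignment with value `i` at `0` and the values of `σ` after it. -/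
def cons (i : ℕ) (σ : ℕ → ℕ) : ℕ → ℕ
  | 0 => i
  | j + 1 => σ j

/-- The body `φ` of a quantifier with the variable `t` in place of the bound variable. -/
def inst (φ : Fml) (t : ℕ) : Fml := rename (cons t id) φ

/-- `StratBy σ φ`: giving each free variable `i` the index `σ i`, one can give an index to each bound
variable of `φ` so that `x ∈ y` only occurs with `y` one above `x`, and `x = y` only with equal
indices. -/
def StratBy : (ℕ → ℕ) → Fml → Prop
  | σ, mem i j => σ j = σ i + 1
  | σ, eq i j => σ i = σ j
  | _, bot => True
  | σ, and φ ψ => StratBy σ φ ∧ StratBy σ ψ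
  | σ, or φ ψ => StratBy σ φ ∧ StratBy σ ψ
  | σ, imp φ ψ => StratBy σ φ ∧ StratBy σ ψ
  | σ, all φ => ∃ k : ℕ, StratBy (cons k σ) φ
  | σ, ex φ => ∃ k : ℕ, StratBy (cons k σ) φ

def Stratified (φ : Fml) : Prop := ∃ σ : ℕ → ℕ, StratBy σ φ

end Fml

open Fml

/-! ### Intuitionistic first-order logic with equality (natural deduction) -/

/-- `Proves T Γ φ`: the formula `φ` is derivable intuitionistically from the axioms `T` (whose free
variables, if any, are read as universally quantified) and the open assumptions `Γ`. -/
inductive Proves (T : Set Fml) : List Fml → Fml → Prop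
  | ax {Γ φ} : φ ∈ T → Proves T Γ φ
  | hyp {Γ φ} : φ ∈ Γ → Proves T Γ φ
  | botE {Γ φ} : Proves T Γ bot → Proves T Γ φ
  | andI {Γ φ ψ} : Proves T Γ φ → Proves T Γ ψ → Proves T Γ (φ ∧ᵢ ψ)
  | andE₁ {Γ φ ψ} : Proves T Γ (φ ∧ᵢ ψ) → Proves T Γ φ
  | andE₂ {Γ φ ψ} : Proves T Γ (φ ∧ᵢ ψ) → Proves T Γ ψ
  | orI₁ {Γ φ ψ} : Proves T Γ φ → Proves T Γ (φ ∨ᵢ ψ)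
  | orI₂ {Γ φ ψ} : Proves T Γ ψ → Proves T Γ (φ ∨ᵢ ψ)
  | orE {Γ φ ψ χ} : Proves T Γ (φ ∨ᵢ ψ) → Proves T (φ :: Γ) χ → Proves T (ψ :: Γ) χ → Proves T Γ χ
  | impI {Γ φ ψ} : Proves T (φ :: Γ) ψ → Proves T Γ (φ →ᵢ ψ)
  | impE {Γ φ ψ} : Proves T Γ (φ →ᵢ ψ) → Proves T Γ φ → Proves T Γ ψ
  | allI {Γ φ} : Proves T (Γ.map shift) φ → Proves T Γ (∀ᵢ φ)
  | allE {Γ} {φ : Fml} (t : ℕ) : Proves T Γ (∀ᵢ φ) → Proves T Γ (φ.inst t)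
  | exI {Γ} {φ : Fml} (t : ℕ) : Proves T Γ (φ.inst t) → Proves T Γ (∃ᵢ φ)
  | exE {Γ} {φ ψ : Fml} : Proves T Γ (∃ᵢ φ) → Proves T (φ :: Γ.map shift) ψ.shift → Proves T Γ ψ
  | eqI {Γ} (t : ℕ) : Proves T Γ (t =ᵢ t)
  | eqE {Γ} {φ : Fml} (s t : ℕ) : Proves T Γ (s =ᵢ t) → Proves T Γ (φ.inst s) → Proves T Γ (φ.inst t)

/-! ### The axioms of INF -/

/-- Two sets with the same elements are equal. -/
def extensionality : Fml :=
  ∀ᵢ ∀ᵢ ((∀ᵢ iff (0 ∈ᵢ 2) (0 ∈ᵢ 1)) →ᵢ 1 =ᵢ 0)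

/-- The set `{x : φ(x)}` exists, i.e. `∃ y, ∀ x, x ∈ y ↔ φ(x)` with `y` not free in `φ`; the variable
`0` of `φ` is `x`, and its free variable `i + 1` is a parameter, which is given the value `ρ i`. -/
def comprehension (φ : Fml) (ρ : ℕ → ℕ) : Fml :=
  ∃ᵢ ∀ᵢ iff (0 ∈ᵢ 1) (φ.rename (cons 0 fun i => ρ i + 2))

/-- Extensionality, and all instances of the universal closure of `∃ y, ∀ x, x ∈ y ↔ φ` for every
stratified `φ`. -/
inductive Axioms : Set Fml
  | ext : Axioms extensionality
  | comp (φ : Fml) (hφ : Stratified φ) (ρ : ℕ → ℕ) : Axioms (comprehension φ ρ)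

/-- `φ` is a theorem of INF: intuitionistic logic, extensionality and stratified comprehension. -/
def Provable (φ : Fml) : Prop := Proves Axioms [] φ

/-! ### Set-theoretic notions, as formulas with the given variables -/

/-- `a ⊆ b` -/
def subset (a b : ℕ) : Fml := ∀ᵢ (0 ∈ᵢ (a + 1) →ᵢ 0 ∈ᵢ (b + 1))

/-- `e = Λ`, the empty set -/
def isEmpty (e : ℕ) : Fml := ∀ᵢ neg (0 ∈ᵢ (e + 1))

/-- `v = u ∪ {z}` -/
def isAdjoin (v u z : ℕ) : Fml :=
  ∀ᵢ iff (0 ∈ᵢ (v + 1)) (0 ∈ᵢ (u + 1) ∨ᵢ 0 =ᵢ (z + 1))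

/-- `b = a ∪ (b - a)` -/
def isUnionDiff (a b : ℕ) : Fml :=
  ∀ᵢ iff (0 ∈ᵢ (b + 1)) (0 ∈ᵢ (a + 1) ∨ᵢ (0 ∈ᵢ (b + 1) ∧ᵢ neg (0 ∈ᵢ (a + 1))))

/-- `u = {x, y}` -/
def isUPair (u x y : ℕ) : Fml := ∀ᵢ iff (0 ∈ᵢ (u + 1)) (0 =ᵢ (x + 1) ∨ᵢ 0 =ᵢ (y + 1))

/-- `u = {x}` -/
def isSingleton (u x : ℕ) : Fml := ∀ᵢ iff (0 ∈ᵢ (u + 1)) (0 =ᵢ (x + 1))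

/-- `p = ⟨x, y⟩ = {{x}, {x, y}}` -/
def isPair (p x y : ℕ) : Fml :=
  ∀ᵢ iff (0 ∈ᵢ (p + 1)) (isSingleton 0 (x + 1) ∨ᵢ isUPair 0 (x + 1) (y + 1))

/-- `⟨x, y⟩ ∈ f` -/
def pairMem (x y f : ℕ) : Fml := ∃ᵢ (isPair 0 (x + 1) (y + 1) ∧ᵢ 0 ∈ᵢ (f + 1))

/-- `f : X → Y`: for every `x ∈ X` there is a unique `y` with `⟨x, y⟩ ∈ f`, and this `y` is in `Y`.
Nothing is said about `⟨x, y⟩ ∈ f` with `x ∉ X`. -/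
def maps (f X Y : ℕ) : Fml :=
  ∀ᵢ (0 ∈ᵢ (X + 1) →ᵢ
    ∃ᵢ (0 ∈ᵢ (Y + 2) ∧ᵢ pairMem 1 0 (f + 2) ∧ᵢ ∀ᵢ (pairMem 2 0 (f + 3) →ᵢ 0 =ᵢ 1)))

/-- `f`, as a map from `X` to `Y`, is onto: `∀ y ∈ Y, ∃ x ∈ X, ⟨x, y⟩ ∈ f`. -/
def onto (f X Y : ℕ) : Fml :=
  ∀ᵢ (0 ∈ᵢ (Y + 1) →ᵢ ∃ᵢ (0 ∈ᵢ (X + 2) ∧ᵢ pairMem 0 1 (f + 2)))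

/-- `f` is one-to-one from `X` to `Y`: `f : X → Y`, and
`∀ x u y, ⟨x, y⟩ ∈ f ∧ ⟨u, y⟩ ∈ f → x = u`, and `∀ x y, y ∈ Y ∧ ⟨x, y⟩ ∈ f → x ∈ X`. -/
def oneOne (f X Y : ℕ) : Fml :=
  maps f X Y ∧ᵢ
  (∀ᵢ ∀ᵢ ∀ᵢ (pairMem 2 0 (f + 3) ∧ᵢ pairMem 1 0 (f + 3) →ᵢ 2 =ᵢ 1)) ∧ᵢ
  (∀ᵢ ∀ᵢ (0 ∈ᵢ (Y + 2) ∧ᵢ pairMem 1 0 (f + 2) →ᵢ 1 ∈ᵢ (X + 2)))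

/-- `dom(f) ⊆ X`: `∀ x y, ⟨x, y⟩ ∈ f → x ∈ X`. -/
def domSubset (f X : ℕ) : Fml := ∀ᵢ ∀ᵢ (pairMem 1 0 (f + 2) →ᵢ 1 ∈ᵢ (X + 2))

/-- `x ∼ y`: some `f : x → y` is one-to-one and onto. -/
def similar (x y : ℕ) : Fml :=
  ∃ᵢ (maps 0 (x + 1) (y + 1) ∧ᵢ oneOne 0 (x + 1) (y + 1) ∧ᵢ onto 0 (x + 1) (y + 1))

/-- `W` contains `Λ`, and contains `u ∪ {z}` whenever `u ∈ W` and `z ∉ u`. -/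
def finClosed (W : ℕ) : Fml :=
  (∃ᵢ (isEmpty 0 ∧ᵢ 0 ∈ᵢ (W + 1))) ∧ᵢ
  (∀ᵢ ∀ᵢ (1 ∈ᵢ (W + 2) ∧ᵢ neg (0 ∈ᵢ 1) →ᵢ ∃ᵢ (isAdjoin 0 2 1 ∧ᵢ 0 ∈ᵢ (W + 3))))

/-- `X` is finite: it belongs to every `W` as in `finClosed`. -/
def finite (X : ℕ) : Fml := ∀ᵢ (finClosed 0 →ᵢ (X + 1) ∈ᵢ 0)

/-- `κ = Nc(x) = {u : u ∼ x}` -/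
def isNc (κ x : ℕ) : Fml := ∀ᵢ iff (0 ∈ᵢ (κ + 1)) (similar 0 (x + 1))

/-- `κ ≤ μ`: there are `a ∈ κ` and `b ∈ μ` with `a ⊆ b` and `b = a ∪ (b - a)`. -/
def le (κ μ : ℕ) : Fml :=
  ∃ᵢ ∃ᵢ (1 ∈ᵢ (κ + 2) ∧ᵢ 0 ∈ᵢ (μ + 2) ∧ᵢ subset 1 0 ∧ᵢ isUnionDiff 1 0)

/-- `Nc(X) ≤ Nc(Y)` -/
def NcLe (X Y : ℕ) : Fml :=
  ∃ᵢ ∃ᵢ (isNc 1 (X + 2) ∧ᵢ isNc 0 (Y + 2) ∧ᵢ le 1 0)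

/-- For all `X` and `f`: if `X` is finite, `f : X → X` is onto and `dom(f) ⊆ X`, then `f` is
one-to-one. -/
def ontoImpliesOneOne : Fml :=
  ∀ᵢ ∀ᵢ (finite 1 →ᵢ maps 0 1 1 →ᵢ onto 0 1 1 →ᵢ domSubset 0 1 →ᵢ oneOne 0 1 1)

/-- For all `X`, `Y` and `f`: if `X` and `Y` are finite, `Nc(X) ≤ Nc(Y)`, `f : X → Y` is onto and
`dom(f) ⊆ X`, then `f` is one-to-one. -/
def ontoImpliesOneOneGeneral : Fml :=
  ∀ᵢ ∀ᵢ ∀ᵢ (finite 2 →ᵢ finite 1 →ᵢ NcLe 2 1 →ᵢ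
    maps 0 2 1 →ᵢ onto 0 2 1 →ᵢ domSubset 0 2 →ᵢ oneOne 0 2 1)

end INF

namespace INF

open Fml

-- Both parts follow from a pigeonhole principle for partial functions: on a finite set `X`, a
-- relation with at most one value in `X` at each point of `X`, and with every point of `X` as a
-- value, is injective and total on `X` (`pigeonhole_of_finite`). This property of `X` is
-- stratified, so it defines a set, and finiteness becomes induction over that set.
--
-- For the step from `V` to `X = V ∪ {z}` with `z ∉ V`, let `g` on `V` be `f` with the value `z`
-- replaced by `f(z)`. Then `g` is functional and onto `V`, so by induction it is injective and
-- total, and both properties pass back to `f`. Partial functions are needed because `g` has no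
-- value at `x` when `f(x) = f(z) = z`; totality of `g` is what excludes this. All case distinctions
-- come from `t ∈ V ∨ t = z` or from the definition of `g`, so the argument is intuitionistic.
--
-- For the second part, `Nc(X) ≤ Nc(Y)` gives `a ⊆ b` with `g : a → X` onto and `h : b → Y`
-- one-to-one. The partial function `f ∘ g ∘ h⁻¹` maps `Y` onto `Y`, hence is injective, and so is
-- `f`.
--
-- Derivations are built inside the calculus; `all_intro` and `ex_elim` let Lean variables stand for
-- fresh object variables.

infix:45 " ⊢ᵢ " => Proves Axioms

/-! ### Renaming of variables -/

theorem lift_comp (ρ σ : ℕ → ℕ) (i : ℕ) : lift σ (lift ρ i) = lift (fun j => σ (ρ j)) i := by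
  cases i <;> rfl

theorem rename_rename (φ : Fml) : ∀ ρ σ : ℕ → ℕ,
    rename σ (rename ρ φ) = rename (fun i => σ (ρ i)) φ := by
  induction φ with
  | mem i j => intros; rfl
  | eq i j => intros; rfl
  | bot => intros; rfl
  | and φ ψ h₁ h₂ | or φ ψ h₁ h₂ | imp φ ψ h₁ h₂ => intro ρ σ; simp only [rename, h₁, h₂]
  | all φ h | ex φ h => intro ρ σ; simp only [rename, h, lift_comp]

/-- A strict upper bound for the free variables of a formula. -/
def Fml.bound : Fml → ℕ
  | mem i j => max i j + 1
  | eq i j => max i j + 1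
  | bot => 0
  | and φ ψ => max φ.bound ψ.bound
  | or φ ψ => max φ.bound ψ.bound
  | imp φ ψ => max φ.bound ψ.bound
  | all φ => φ.bound
  | ex φ => φ.bound

theorem lift_congr {ρ σ : ℕ → ℕ} {n : ℕ} (h : ∀ i < n, ρ i = σ i) : ∀ i < n, lift ρ i = lift σ i
  | 0, _ => rfl
  | i + 1, hi => congrArg (· + 1) (h i (by omega))

theorem rename_congr (φ : Fml) : ∀ {ρ σ : ℕ → ℕ}, (∀ i < φ.bound, ρ i = σ i) →
    rename ρ φ = rename σ φ := by
  induction φ with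
  | mem i j | eq i j =>
    intro ρ σ h
    simp only [rename]
    rw [h i (by simp only [bound]; omega), h j (by simp only [bound]; omega)]
  | bot => intros; rfl
  | and φ ψ h₁ h₂ | or φ ψ h₁ h₂ | imp φ ψ h₁ h₂ =>
    intro ρ σ h
    simp only [rename]
    rw [h₁ fun i hi => h i (lt_max_of_lt_left hi), h₂ fun i hi => h i (lt_max_of_lt_right hi)]
  | all φ ih | ex φ ih =>
    intro ρ σ h
    simp only [rename]
    rw [ih (lift_congr h)]

theorem rename_inst (φ : Fml) (ρ : ℕ → ℕ) (t : ℕ) :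
    (φ.inst t).rename ρ = (φ.rename (lift ρ)).inst (ρ t) := by
  simp only [inst, rename_rename]
  congr 1
  funext i
  cases i <;> rfl

theorem rename_shift (φ : Fml) (ρ : ℕ → ℕ) : φ.shift.rename (lift ρ) = (φ.rename ρ).shift := by
  simp only [shift, rename_rename]
  rfl

theorem map_shift_rename (Γ : List Fml) (ρ : ℕ → ℕ) :
    (Γ.map shift).map (rename (lift ρ)) = (Γ.map (rename ρ)).map shift := by
  simp only [List.map_map]
  exact List.map_congr_left fun φ _ => rename_shift φ ρ

/-- This is why the comprehension scheme carries a renaming of its parameters: a further renaming is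
absorbed by composition. -/
theorem axioms_rename {φ : Fml} (h : φ ∈ Axioms) (ρ : ℕ → ℕ) : φ.rename ρ ∈ Axioms := by
  cases h with
  | ext => exact Axioms.ext
  | comp φ hφ σ =>
    have : (comprehension φ σ).rename ρ = comprehension φ fun i => ρ (σ i) := by
      simp only [comprehension, Fml.iff, rename, rename_rename]
      congr
      all_goals
        funext i
        cases i <;> rfl
    rw [this]
    exact Axioms.comp φ hφ _

/-! ### Admissible rules -/

theorem Proves.weaken {Γ : List Fml} {φ : Fml} (h : Γ ⊢ᵢ φ) :
    ∀ {Δ : List Fml}, Γ ⊆ Δ → Δ ⊢ᵢ φ := by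
  induction h with
  | ax h => intro _ _; exact .ax h
  | hyp h => intro _ s; exact .hyp (s h)
  | botE _ h => intro _ s; exact .botE (h s)
  | andI _ _ h₁ h₂ => intro _ s; exact .andI (h₁ s) (h₂ s)
  | andE₁ _ h => intro _ s; exact .andE₁ (h s)
  | andE₂ _ h => intro _ s; exact .andE₂ (h s)
  | orI₁ _ h => intro _ s; exact .orI₁ (h s)
  | orI₂ _ h => intro _ s; exact .orI₂ (h s)
  | orE _ _ _ h h₁ h₂ =>
    intro _ s; exact .orE (h s) (h₁ (List.cons_subset_cons _ s)) (h₂ (List.cons_subset_cons _ s))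
  | impI _ h => intro _ s; exact .impI (h (List.cons_subset_cons _ s))
  | impE _ _ h₁ h₂ => intro _ s; exact .impE (h₁ s) (h₂ s)
  | allI _ h => intro _ s; exact .allI (h (List.map_subset _ s))
  | allE t _ h => intro _ s; exact .allE t (h s)
  | exI t _ h => intro _ s; exact .exI t (h s)
  | exE _ _ h₁ h₂ =>
    intro _ s; exact .exE (h₁ s) (h₂ (List.cons_subset_cons _ (List.map_subset _ s)))
  | eqI t => intro _ _; exact .eqI t
  | eqE a b _ _ h₁ h₂ => intro _ s; exact .eqE a b (h₁ s) (h₂ s)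

theorem Proves.rename {Γ : List Fml} {φ : Fml} (h : Γ ⊢ᵢ φ) :
    ∀ ρ : ℕ → ℕ, Γ.map (Fml.rename ρ) ⊢ᵢ φ.rename ρ := by
  induction h with
  | ax h => intro ρ; exact .ax (axioms_rename h ρ)
  | hyp h => intro ρ; exact .hyp (List.mem_map_of_mem h)
  | botE _ h => intro ρ; exact .botE (h ρ)
  | andI _ _ h₁ h₂ => intro ρ; exact .andI (h₁ ρ) (h₂ ρ)
  | andE₁ _ h => intro ρ; exact .andE₁ (h ρ)
  | andE₂ _ h => intro ρ; exact .andE₂ (h ρ)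
  | orI₁ _ h => intro ρ; exact .orI₁ (h ρ)
  | orI₂ _ h => intro ρ; exact .orI₂ (h ρ)
  | orE _ _ _ h h₁ h₂ => intro ρ; exact .orE (h ρ) (h₁ ρ) (h₂ ρ)
  | impI _ h => intro ρ; exact .impI (h ρ)
  | impE _ _ h₁ h₂ => intro ρ; exact .impE (h₁ ρ) (h₂ ρ)
  | allI _ h =>
    intro ρ
    have := h (lift ρ)
    rw [map_shift_rename] at this
    exact .allI this
  | allE t _ h =>
    intro ρ
    rw [rename_inst]
    exact .allE (ρ t) (h ρ)
  | exI t _ h =>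
    intro ρ
    have := h ρ
    rw [rename_inst] at this
    exact .exI (ρ t) this
  | exE _ _ h₁ h₂ =>
    intro ρ
    have := h₂ (lift ρ)
    rw [List.map_cons, map_shift_rename, rename_shift] at this
    exact .exE (h₁ ρ) this
  | eqI t => intro ρ; exact .eqI (ρ t)
  | eqE a b _ _ h₁ h₂ =>
    intro ρ
    have := h₂ ρ
    rw [rename_inst] at this ⊢
    exact .eqE (ρ a) (ρ b) (h₁ ρ) this

/-- A bound for the free variables of all formulas of a list. -/
theorem exists_bound (Γ : List Fml) : ∃ n, ∀ φ ∈ Γ, φ.bound ≤ n := by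
  induction Γ with
  | nil => exact ⟨0, by simp⟩
  | cons φ Γ ih =>
    obtain ⟨n, hn⟩ := ih
    refine ⟨max φ.bound n, fun ψ hψ => ?_⟩
    rcases List.mem_cons.1 hψ with rfl | hψ
    · exact le_max_left _ _
    · exact (hn ψ hψ).trans (le_max_right _ _)

/-- The renaming that makes the variable `t` the one bound by a new quantifier. -/
def abstractVar (t i : ℕ) : ℕ := if i = t then 0 else i + 1

theorem rename_abstractVar {φ : Fml} {t : ℕ} (h : φ.bound ≤ t) :
    φ.rename (abstractVar t) = φ.shift :=
  rename_congr φ fun i hi => by simp only [abstractVar]; rw [if_neg (by omega)]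

theorem map_rename_abstractVar {Γ : List Fml} {t : ℕ} (h : ∀ φ ∈ Γ, φ.bound ≤ t) :
    Γ.map (rename (abstractVar t)) = Γ.map shift :=
  List.map_congr_left fun φ hφ => rename_abstractVar (h φ hφ)

theorem rename_id (φ : Fml) : φ.rename id = φ := by
  have lift_id : lift id = id := by funext i; cases i <;> rfl
  induction φ with
  | mem i j | eq i j | bot => rfl
  | and φ ψ h₁ h₂ | or φ ψ h₁ h₂ | imp φ ψ h₁ h₂ => simp only [rename, h₁, h₂]
  | all φ h | ex φ h => simp only [rename, lift_id, h]

theorem inst_rename_abstractVar {φ : Fml} {t : ℕ} (h : φ.bound ≤ t) :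
    (φ.inst t).rename (abstractVar t) = φ := by
  conv_rhs => rw [← rename_id φ]
  rw [inst, rename_rename]
  refine rename_congr φ fun i hi => ?_
  cases i with
  | zero => simp [cons, abstractVar]
  | succ i => exact if_neg (by omega : i ≠ t)

/-- Take `t` beyond all free variables of `φ` and `Γ`; abstracting it turns the instance back into
`φ` and acts on `Γ` as a shift, which is the premise of the formal rule. -/
theorem all_intro {Γ : List Fml} {φ : Fml} (h : ∀ t, Γ ⊢ᵢ φ.inst t) : Γ ⊢ᵢ ∀ᵢ φ := by
  obtain ⟨t, ht⟩ := exists_bound (φ :: Γ)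
  have := (h t).rename (abstractVar t)
  rw [map_rename_abstractVar fun ψ hψ => ht ψ (List.mem_cons_of_mem _ hψ),
    inst_rename_abstractVar (ht φ List.mem_cons_self)] at this
  exact .allI this

theorem ex_elim {Γ : List Fml} {φ ψ : Fml} (h : Γ ⊢ᵢ ∃ᵢ φ)
    (h' : ∀ t, φ.inst t :: Γ ⊢ᵢ φ.inst t → φ.inst t :: Γ ⊢ᵢ ψ) : Γ ⊢ᵢ ψ := by
  obtain ⟨t, ht⟩ := exists_bound (ψ :: φ :: Γ)
  have := (h' t (.hyp List.mem_cons_self)).rename (abstractVar t)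
  rw [List.map_cons, map_rename_abstractVar fun χ hχ => ht χ (by simp [hχ]),
    inst_rename_abstractVar (ht φ (by simp)), rename_abstractVar (ht ψ (by simp))] at this
  exact .exE h this

theorem imp_intro {Γ : List Fml} {φ ψ : Fml} (h : φ :: Γ ⊢ᵢ φ → φ :: Γ ⊢ᵢ ψ) : Γ ⊢ᵢ φ →ᵢ ψ :=
  .impI (h (.hyp List.mem_cons_self))

theorem or_elim {Γ : List Fml} {φ ψ χ : Fml} (h : Γ ⊢ᵢ φ ∨ᵢ ψ) (h₁ : φ :: Γ ⊢ᵢ φ → φ :: Γ ⊢ᵢ χ)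
    (h₂ : ψ :: Γ ⊢ᵢ ψ → ψ :: Γ ⊢ᵢ χ) : Γ ⊢ᵢ χ :=
  .orE h (h₁ (.hyp List.mem_cons_self)) (h₂ (.hyp List.mem_cons_self))

theorem iff_mp {Γ : List Fml} {φ ψ : Fml} (h : Γ ⊢ᵢ φ.iff ψ) (h' : Γ ⊢ᵢ φ) : Γ ⊢ᵢ ψ :=
  .impE (.andE₁ h) h'

theorem iff_mpr {Γ : List Fml} {φ ψ : Fml} (h : Γ ⊢ᵢ φ.iff ψ) (h' : Γ ⊢ᵢ ψ) : Γ ⊢ᵢ φ :=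
  .impE (.andE₂ h) h'

theorem eq_symm {Γ : List Fml} {x y : ℕ} (h : Γ ⊢ᵢ x =ᵢ y) : Γ ⊢ᵢ y =ᵢ x :=
  -- The formula rewritten is `w = x`, with the hole `w` as variable `0` and hence `x` shifted by
  -- one.
  .eqE (φ := 0 =ᵢ (x + 1)) x y h (.eqI x)

theorem eq_trans {Γ : List Fml} {x y z : ℕ} (h : Γ ⊢ᵢ x =ᵢ y) (h' : Γ ⊢ᵢ y =ᵢ z) : Γ ⊢ᵢ x =ᵢ z :=
  .eqE (φ := (x + 1) =ᵢ 0) y z h' h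

theorem mem_of_eq {Γ : List Fml} {x y X : ℕ} (h : Γ ⊢ᵢ x =ᵢ y) (h' : Γ ⊢ᵢ x ∈ᵢ X) : Γ ⊢ᵢ y ∈ᵢ X :=
  .eqE (φ := 0 ∈ᵢ (X + 1)) x y h h'

theorem pairMem_of_eq_left {Γ : List Fml} {x x' y f : ℕ} (h : Γ ⊢ᵢ x =ᵢ x')
    (h' : Γ ⊢ᵢ pairMem x y f) : Γ ⊢ᵢ pairMem x' y f :=
  .eqE (φ := pairMem 0 (y + 1) (f + 1)) x x' h h'

theorem pairMem_of_eq_right {Γ : List Fml} {x y y' f : ℕ} (h : Γ ⊢ᵢ y =ᵢ y')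
    (h' : Γ ⊢ᵢ pairMem x y f) : Γ ⊢ᵢ pairMem x y' f :=
  .eqE (φ := pairMem (x + 1) 0 (f + 1)) y y' h h'

/-- Inclusion of contexts, found by instance search for contexts that extend each other. -/
class Sub (Γ Δ : List Fml) : Prop where
  sub : Γ ⊆ Δ

instance (Γ : List Fml) : Sub Γ Γ := ⟨fun _ h => h⟩

instance (φ : Fml) (Γ Δ : List Fml) [h : Sub Γ Δ] : Sub Γ (φ :: Δ) :=
  ⟨fun _ h' => List.mem_cons_of_mem _ (h.sub h')⟩

theorem Proves.up {Γ Δ : List Fml} {φ : Fml} [s : Sub Γ Δ] (h : Γ ⊢ᵢ φ) : Δ ⊢ᵢ φ :=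
  h.weaken s.sub

/-! ### Comprehension -/

theorem stratBy_rename (φ : Fml) : ∀ {σ ρ : ℕ → ℕ}, StratBy (fun i => σ (ρ i)) φ →
    StratBy σ (φ.rename ρ) := by
  have key : ∀ (k : ℕ) (σ ρ : ℕ → ℕ), (fun i => cons k σ (lift ρ i)) = cons k fun i => σ (ρ i) := by
    intro k σ ρ
    funext i
    cases i <;> rfl
  induction φ with
  | mem i j | eq i j | bot => exact fun h => h
  | and φ ψ h₁ h₂ | or φ ψ h₁ h₂ | imp φ ψ h₁ h₂ => exact fun h => ⟨h₁ h.1, h₂ h.2⟩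
  | all φ h | ex φ h =>
    rintro σ ρ ⟨k, hk⟩
    exact ⟨k, h (by rwa [key])⟩

/-- `y = {x : φ(x)}`, with the values `ρ` of the parameters. -/
def isComp (y : ℕ) (φ : Fml) (ρ : ℕ → ℕ) : Fml :=
  ∀ᵢ iff (0 ∈ᵢ (y + 1)) (φ.rename (cons 0 fun i => ρ i + 1))

theorem comp_elim {Γ : List Fml} {φ χ : Fml} (hφ : Stratified φ) (ρ : ℕ → ℕ)
    (h : ∀ y, isComp y φ ρ :: Γ ⊢ᵢ isComp y φ ρ → isComp y φ ρ :: Γ ⊢ᵢ χ) : Γ ⊢ᵢ χ := by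
  refine ex_elim (.ax (Axioms.comp φ hφ ρ)) fun y => ?_
  convert h y using 3
  all_goals
    simp only [isComp, inst, rename, Fml.iff, rename_rename]
    congr
    all_goals
      funext i
      cases i <;> rfl

theorem mem_iff_of_isComp {Γ : List Fml} {y : ℕ} {φ : Fml} {ρ : ℕ → ℕ} (h : Γ ⊢ᵢ isComp y φ ρ)
    (t : ℕ) : Γ ⊢ᵢ iff (t ∈ᵢ y) (φ.rename (cons t ρ)) := by
  convert Proves.allE t h using 1
  simp only [inst, rename, Fml.iff, rename_rename]
  congr
  all_goals
    funext i
    cases i <;> rfl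

/-! ### Ordered pairs -/

theorem exists_singleton {Γ : List Fml} {χ : Fml} (x : ℕ)
    (h : ∀ s, isSingleton s x :: Γ ⊢ᵢ isSingleton s x → isSingleton s x :: Γ ⊢ᵢ χ) : Γ ⊢ᵢ χ :=
  comp_elim (φ := 0 =ᵢ 1) ⟨fun _ => 0, rfl⟩ (fun _ => x) h

theorem exists_upair {Γ : List Fml} {χ : Fml} (x y : ℕ)
    (h : ∀ s, isUPair s x y :: Γ ⊢ᵢ isUPair s x y → isUPair s x y :: Γ ⊢ᵢ χ) : Γ ⊢ᵢ χ :=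
  comp_elim (φ := 0 =ᵢ 1 ∨ᵢ 0 =ᵢ 2) ⟨fun _ => 0, rfl, rfl⟩ (cons x fun _ => y) h

section
variable {Γ : List Fml}

theorem mem_singleton {s x : ℕ} (h : Γ ⊢ᵢ isSingleton s x) (t : ℕ) :
    Γ ⊢ᵢ iff (t ∈ᵢ s) (t =ᵢ x) :=
  .allE t h

theorem mem_upair {s x y : ℕ} (h : Γ ⊢ᵢ isUPair s x y) (t : ℕ) :
    Γ ⊢ᵢ iff (t ∈ᵢ s) (t =ᵢ x ∨ᵢ t =ᵢ y) :=
  .allE t h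

theorem mem_pair {p x y : ℕ} (h : Γ ⊢ᵢ isPair p x y) (t : ℕ) :
    Γ ⊢ᵢ iff (t ∈ᵢ p) (isSingleton t x ∨ᵢ isUPair t x y) :=
  .allE t h

/-- The singleton of `x` belongs to `p`, so it is `{x'}` or `{x', y'}`; either way `x'` lies in it.
-/
theorem fst_eq_of_isPair {p x y x' y' : ℕ} (h : Γ ⊢ᵢ isPair p x y) (h' : Γ ⊢ᵢ isPair p x' y') :
    Γ ⊢ᵢ x =ᵢ x' :=
  exists_singleton x fun s hs =>
    or_elim (iff_mp (mem_pair h'.up s) (iff_mpr (mem_pair h.up s) (.orI₁ hs)))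
      (fun hs' => eq_symm (iff_mp (mem_singleton hs.up x') (iff_mpr (mem_singleton hs' x') (.eqI x'))))
      (fun hs' => eq_symm (iff_mp (mem_singleton hs.up x')
        (iff_mpr (mem_upair hs' x') (.orI₁ (.eqI x')))))

theorem snd_eq_or_of_isPair {p x y x' y' : ℕ} (h : Γ ⊢ᵢ isPair p x y) (h' : Γ ⊢ᵢ isPair p x' y') :
    Γ ⊢ᵢ y =ᵢ x' ∨ᵢ y =ᵢ y' :=
  exists_upair x y fun s hs =>
    have hy := iff_mpr (mem_upair hs y) (.orI₂ (.eqI y))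
    or_elim (iff_mp (mem_pair h'.up s) (iff_mpr (mem_pair h.up s) (.orI₂ hs)))
      (fun hs' => .orI₁ (iff_mp (mem_singleton hs' y) hy.up))
      (fun hs' => iff_mp (mem_upair hs' y) hy.up)

/-- By symmetry `y ∈ {x', y'}` and `y' ∈ {x, y}`. The only case not immediate is `y = x'`, `y' = x`,
settled by `x = x'`. Equality need not be decided. -/
theorem snd_eq_of_isPair {p x y x' y' : ℕ} (h : Γ ⊢ᵢ isPair p x y) (h' : Γ ⊢ᵢ isPair p x' y') :
    Γ ⊢ᵢ y =ᵢ y' :=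
  or_elim (snd_eq_or_of_isPair h h')
    (fun hy => or_elim (snd_eq_or_of_isPair h'.up h.up)
      (fun hy' => eq_trans hy.up (eq_trans (eq_symm (fst_eq_of_isPair h.up h'.up)) (eq_symm hy')))
      (fun hy' => eq_symm hy'))
    (fun hy => hy)

theorem exists_pair {χ : Fml} (x y : ℕ)
    (h : ∀ p, isPair p x y :: Γ ⊢ᵢ isPair p x y → isPair p x y :: Γ ⊢ᵢ χ) : Γ ⊢ᵢ χ :=
  comp_elim (φ := isSingleton 0 1 ∨ᵢ isUPair 0 1 2)
    ⟨cons 1 fun _ => 0, ⟨0, ⟨rfl, rfl⟩, rfl, rfl⟩,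
      ⟨0, ⟨rfl, rfl, rfl⟩, ⟨rfl, rfl⟩, rfl⟩⟩ (cons x fun _ => y) h

end

/-! ### Stratified definitions of relations -/

/-- A Kuratowski pair lies two levels above its components, which must share a level; a relation
therefore lies three above. -/
theorem stratBy_isPair {σ : ℕ → ℕ} {p x y : ℕ} (hy : σ y = σ x) (hp : σ p = σ x + 2) :
    StratBy σ (isPair p x y) := by
  refine ⟨σ x + 1, ⟨?_, ⟨σ x, ?_⟩, σ x, ?_⟩, ⟨⟨σ x, ?_⟩, σ x, ?_⟩, ?_⟩ <;>
    simp [Fml.iff, StratBy, cons, hy, hp]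

theorem stratBy_pairMem {σ : ℕ → ℕ} {x y f : ℕ} (hy : σ y = σ x) (hf : σ f = σ x + 3) :
    StratBy σ (pairMem x y f) :=
  ⟨σ x + 2, stratBy_isPair hy rfl, hf⟩

/-- `φ(x, y)` with the values `ρ` of the parameters. -/
def relAt (φ : Fml) (ρ : ℕ → ℕ) (x y : ℕ) : Fml := φ.rename (cons x (cons y ρ))

/-- `g` contains exactly those pairs `⟨x, y⟩` for which `φ(x, y)`. -/
def isRel (g : ℕ) (φ : Fml) (ρ : ℕ → ℕ) : Fml :=
  ∀ᵢ ∀ᵢ iff (pairMem 1 0 (g + 2)) (relAt φ (fun i => ρ i + 2) 1 0)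

theorem pairMem_iff_of_isRel {Γ : List Fml} {g : ℕ} {φ : Fml} {ρ : ℕ → ℕ} (h : Γ ⊢ᵢ isRel g φ ρ)
    (x y : ℕ) : Γ ⊢ᵢ iff (pairMem x y g) (relAt φ ρ x y) := by
  have := Proves.allE y (Proves.allE x h)
  have e : (inst (rename (lift (cons x id)) (relAt φ (fun i => ρ i + 2) 1 0)) y) = relAt φ ρ x y := by
    simp only [inst, relAt, rename_rename]
    congr 1
    funext i
    rcases i with _ | _ | i <;> rfl
  rw [← e]
  exact this

theorem relAt_of_eq {Γ : List Fml} {φ : Fml} {ρ : ℕ → ℕ} {x y x' y' : ℕ} (hx : Γ ⊢ᵢ x =ᵢ x')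
    (hy : Γ ⊢ᵢ y =ᵢ y') (h : Γ ⊢ᵢ relAt φ ρ x y) : Γ ⊢ᵢ relAt φ ρ x' y' := by
  have e₁ : ∀ t, (relAt φ (fun i => ρ i + 1) 0 (y + 1)).inst t = relAt φ ρ t y := by
    intro t
    simp only [inst, relAt, rename_rename]
    congr 1
    funext i
    rcases i with _ | _ | i <;> rfl
  have e₂ : ∀ t, (relAt φ (fun i => ρ i + 1) (x' + 1) 0).inst t = relAt φ ρ x' t := by
    intro t
    simp only [inst, relAt, rename_rename]
    congr 1
    funext i
    rcases i with _ | _ | i <;> rfl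
  rw [← e₁] at h
  have h' := Proves.eqE x x' hx h
  rw [e₁, ← e₂] at h'
  have h'' := Proves.eqE y y' hy h'
  rwa [e₂] at h''

/-- Comprehension is applied to `∃ x y, p = ⟨x, y⟩ ∧ φ(x, y)`. The condition `σ 1 = σ 0` makes the
pair stratified, and uniqueness of components recovers `φ(x, y)` from `⟨x, y⟩ ∈ g`. -/
theorem rel_elim {Γ : List Fml} {φ χ : Fml} {σ : ℕ → ℕ} (hφ : StratBy σ φ) (h01 : σ 1 = σ 0)
    (ρ : ℕ → ℕ) (h : ∀ g, isRel g φ ρ :: Γ ⊢ᵢ isRel g φ ρ → isRel g φ ρ :: Γ ⊢ᵢ χ) : Γ ⊢ᵢ χ := by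
  let ψ : Fml := ∃ᵢ ∃ᵢ (isPair 2 1 0 ∧ᵢ φ.rename (cons 1 (cons 0 fun i => i + 3)))
  have hψ : Stratified ψ := by
    -- The pair gets the index two above its components; the parameters of `φ` keep theirs.
    refine ⟨cons (σ 0 + 2) fun i => σ (i + 2), σ 0, σ 0, stratBy_isPair rfl rfl, stratBy_rename _ ?_⟩
    convert hφ using 1
    funext i
    rcases i with _ | _ | i
    · rfl
    · exact h01.symm
    · rfl
  have eψ : ∀ p x y, inst (rename (lift (cons x id)) (rename (lift (lift (cons p ρ)))
      (isPair 2 1 0 ∧ᵢ φ.rename (cons 1 (cons 0 fun i => i + 3))))) y =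
      (isPair p x y ∧ᵢ relAt φ ρ x y) := by
    intro p x y
    simp only [inst, relAt, rename, rename_rename]
    congr 2
    funext i
    rcases i with _ | _ | i <;> rfl
  refine comp_elim hψ ρ fun g hg => ?_
  suffices hr : isComp g ψ ρ :: Γ ⊢ᵢ isRel g φ ρ from
    .impE (Proves.impI (h g (.hyp List.mem_cons_self))).up hr
  have eφ : ∀ x y, inst (rename (lift (cons x id)) (relAt φ (fun i => ρ i + 2) 1 0)) y =
      relAt φ ρ x y := by
    intro x y
    simp only [inst, relAt, rename_rename]
    congr 1
    funext i
    rcases i with _ | _ | i <;> rfl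
  refine all_intro fun x => all_intro fun y => ?_
  change _ ⊢ᵢ iff (pairMem x y g) (inst (rename (lift (cons x id)) (relAt φ (fun i => ρ i + 2) 1 0)) y)
  rw [eφ]
  refine .andI (imp_intro fun hp => ?_) (imp_intro fun hr => ?_)
  · refine ex_elim hp fun p hp => ?_
    have hp₁ : _ ⊢ᵢ isPair p x y := .andE₁ hp
    have hp₂ : _ ⊢ᵢ p ∈ᵢ g := .andE₂ hp
    refine ex_elim (iff_mp (mem_iff_of_isComp hg.up p) hp₂) fun x' hx' => ?_
    refine ex_elim hx' fun y' hy' => ?_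
    have hc := (congrArg (Proves Axioms _) (eψ p x' y')).mp hy'
    exact relAt_of_eq (fst_eq_of_isPair (.andE₁ hc) hp₁.up) (snd_eq_of_isPair (.andE₁ hc) hp₁.up)
      (.andE₂ hc)
  · refine exists_pair x y fun p hp => ?_
    refine .exI p (.andI hp (iff_mpr (mem_iff_of_isComp hg.up p) (.exI x (.exI y ?_))))
    have hc : _ ⊢ᵢ isPair p x y ∧ᵢ relAt φ ρ x y := .andI hp hr.up
    rw [← eψ p x y] at hc
    exact hc

/-! ### Functional relations on a set -/

/-- `∀ x y y' ∈ X, ⟨x, y⟩ ∈ f → ⟨x, y'⟩ ∈ f → y = y'` -/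
def functionalOn (f X : ℕ) : Fml :=
  ∀ᵢ ∀ᵢ ∀ᵢ (2 ∈ᵢ (X + 3) →ᵢ 1 ∈ᵢ (X + 3) →ᵢ 0 ∈ᵢ (X + 3) →ᵢ pairMem 2 1 (f + 3) →ᵢ
    pairMem 2 0 (f + 3) →ᵢ 1 =ᵢ 0)

/-- `∀ x u y ∈ X, ⟨x, y⟩ ∈ f → ⟨u, y⟩ ∈ f → x = u` -/
def injectiveOn (f X : ℕ) : Fml :=
  ∀ᵢ ∀ᵢ ∀ᵢ (2 ∈ᵢ (X + 3) →ᵢ 1 ∈ᵢ (X + 3) →ᵢ 0 ∈ᵢ (X + 3) →ᵢ pairMem 2 0 (f + 3) →ᵢ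
    pairMem 1 0 (f + 3) →ᵢ 2 =ᵢ 1)

/-- `∀ x ∈ X, ∃ y ∈ X, ⟨x, y⟩ ∈ f` -/
def totalOn (f X : ℕ) : Fml :=
  ∀ᵢ (0 ∈ᵢ (X + 1) →ᵢ ∃ᵢ (0 ∈ᵢ (X + 2) ∧ᵢ pairMem 1 0 (f + 2)))

/-- Every partial function from `X` onto `X` is injective and total. -/
def pigeonhole (X : ℕ) : Fml :=
  ∀ᵢ (functionalOn 0 (X + 1) →ᵢ onto 0 (X + 1) (X + 1) →ᵢ
    injectiveOn 0 (X + 1) ∧ᵢ totalOn 0 (X + 1))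

section
variable {Γ : List Fml} {f g X Y V z e : ℕ}

theorem functionalOn_intro (h : ∀ x y y', Γ ⊢ᵢ x ∈ᵢ X →ᵢ y ∈ᵢ X →ᵢ y' ∈ᵢ X →ᵢ pairMem x y f →ᵢ
    pairMem x y' f →ᵢ y =ᵢ y') : Γ ⊢ᵢ functionalOn f X :=
  all_intro fun x => all_intro fun y => all_intro fun y' => h x y y'

theorem functionalOn_elim (h : Γ ⊢ᵢ functionalOn f X) {x y y' : ℕ} (hx : Γ ⊢ᵢ x ∈ᵢ X)
    (hy : Γ ⊢ᵢ y ∈ᵢ X) (hy' : Γ ⊢ᵢ y' ∈ᵢ X) (h₁ : Γ ⊢ᵢ pairMem x y f) (h₂ : Γ ⊢ᵢ pairMem x y' f) :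
    Γ ⊢ᵢ y =ᵢ y' := by
  have : Γ ⊢ᵢ x ∈ᵢ X →ᵢ y ∈ᵢ X →ᵢ y' ∈ᵢ X →ᵢ pairMem x y f →ᵢ pairMem x y' f →ᵢ y =ᵢ y' :=
    .allE y' (.allE y (.allE x h))
  exact .impE (.impE (.impE (.impE (.impE this hx) hy) hy') h₁) h₂

theorem injectiveOn_intro (h : ∀ x u y, Γ ⊢ᵢ x ∈ᵢ X →ᵢ u ∈ᵢ X →ᵢ y ∈ᵢ X →ᵢ pairMem x y f →ᵢ
    pairMem u y f →ᵢ x =ᵢ u) : Γ ⊢ᵢ injectiveOn f X :=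
  all_intro fun x => all_intro fun u => all_intro fun y => h x u y

theorem injectiveOn_elim (h : Γ ⊢ᵢ injectiveOn f X) {x u y : ℕ} (hx : Γ ⊢ᵢ x ∈ᵢ X)
    (hu : Γ ⊢ᵢ u ∈ᵢ X) (hy : Γ ⊢ᵢ y ∈ᵢ X) (h₁ : Γ ⊢ᵢ pairMem x y f) (h₂ : Γ ⊢ᵢ pairMem u y f) :
    Γ ⊢ᵢ x =ᵢ u := by
  have : Γ ⊢ᵢ x ∈ᵢ X →ᵢ u ∈ᵢ X →ᵢ y ∈ᵢ X →ᵢ pairMem x y f →ᵢ pairMem u y f →ᵢ x =ᵢ u :=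
    .allE y (.allE u (.allE x h))
  exact .impE (.impE (.impE (.impE (.impE this hx) hu) hy) h₁) h₂

theorem onto_intro (h : ∀ y, Γ ⊢ᵢ y ∈ᵢ Y →ᵢ ∃ᵢ (0 ∈ᵢ (X + 1) ∧ᵢ pairMem 0 (y + 1) (f + 1))) :
    Γ ⊢ᵢ onto f X Y :=
  all_intro h

theorem onto_elim (h : Γ ⊢ᵢ onto f X Y) {y : ℕ} (hy : Γ ⊢ᵢ y ∈ᵢ Y) {χ : Fml}
    (k : ∀ x, (x ∈ᵢ X ∧ᵢ pairMem x y f) :: Γ ⊢ᵢ x ∈ᵢ X →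
      (x ∈ᵢ X ∧ᵢ pairMem x y f) :: Γ ⊢ᵢ pairMem x y f →
      (x ∈ᵢ X ∧ᵢ pairMem x y f) :: Γ ⊢ᵢ χ) : Γ ⊢ᵢ χ := by
  have : Γ ⊢ᵢ y ∈ᵢ Y →ᵢ ∃ᵢ (0 ∈ᵢ (X + 1) ∧ᵢ pairMem 0 (y + 1) (f + 1)) := .allE y h
  exact ex_elim (.impE this hy) fun x hx => k x (.andE₁ hx) (.andE₂ hx)

theorem totalOn_intro (h : ∀ x, Γ ⊢ᵢ x ∈ᵢ X →ᵢ ∃ᵢ (0 ∈ᵢ (X + 1) ∧ᵢ pairMem (x + 1) 0 (f + 1))) :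
    Γ ⊢ᵢ totalOn f X :=
  all_intro h

theorem totalOn_elim (h : Γ ⊢ᵢ totalOn f X) {x : ℕ} (hx : Γ ⊢ᵢ x ∈ᵢ X) {χ : Fml}
    (k : ∀ y, (y ∈ᵢ X ∧ᵢ pairMem x y f) :: Γ ⊢ᵢ y ∈ᵢ X →
      (y ∈ᵢ X ∧ᵢ pairMem x y f) :: Γ ⊢ᵢ pairMem x y f →
      (y ∈ᵢ X ∧ᵢ pairMem x y f) :: Γ ⊢ᵢ χ) : Γ ⊢ᵢ χ := by
  have : Γ ⊢ᵢ x ∈ᵢ X →ᵢ ∃ᵢ (0 ∈ᵢ (X + 1) ∧ᵢ pairMem (x + 1) 0 (f + 1)) := .allE x h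
  exact ex_elim (.impE this hx) fun y hy => k y (.andE₁ hy) (.andE₂ hy)

theorem pigeonhole_elim (h : Γ ⊢ᵢ pigeonhole X) (hf : Γ ⊢ᵢ functionalOn f X)
    (ho : Γ ⊢ᵢ onto f X X) : Γ ⊢ᵢ injectiveOn f X ∧ᵢ totalOn f X := by
  have : Γ ⊢ᵢ functionalOn f X →ᵢ onto f X X →ᵢ injectiveOn f X ∧ᵢ totalOn f X := .allE f h
  exact .impE (.impE this hf) ho

theorem pigeonhole_of_isEmpty (h : Γ ⊢ᵢ isEmpty e) : Γ ⊢ᵢ pigeonhole e := by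
  have hn : ∀ t, Γ ⊢ᵢ neg (t ∈ᵢ e) := fun t => .allE t h
  exact all_intro fun f => imp_intro fun _ => imp_intro fun _ => .andI
    (injectiveOn_intro fun x _ _ => imp_intro fun hx => .botE (.impE (hn x).up hx))
    (totalOn_intro fun x => imp_intro fun hx => .botE (.impE (hn x).up hx))

/-- `f` on `V`, with `f(z)` in place of the value `z`: the variables of
`x ∈ V ∧ y ∈ V ∧ (f(x) = y ∨ f(x) = z ∧ f(z) = y)` are `x = 0`, `y = 1`, `V = 2`, `z = 3`, `f = 4`. -/
def bypass : Fml :=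
  0 ∈ᵢ 2 ∧ᵢ 1 ∈ᵢ 2 ∧ᵢ (pairMem 0 1 4 ∨ᵢ (pairMem 0 3 4 ∧ᵢ pairMem 3 1 4))

theorem bypass_elim {Γ : List Fml} {χ : Fml} (V z f : ℕ)
    (h : ∀ (g : ℕ) (A : Fml), (∀ x y, A :: Γ ⊢ᵢ iff (pairMem x y g)
      (x ∈ᵢ V ∧ᵢ y ∈ᵢ V ∧ᵢ (pairMem x y f ∨ᵢ (pairMem x z f ∧ᵢ pairMem z y f)))) → A :: Γ ⊢ᵢ χ) :
    Γ ⊢ᵢ χ := by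
  -- Points have index `0`, the set `V` index `1`, the relation `f` index `3`.
  refine rel_elim (φ := bypass) (σ := fun | 0 => 0 | 1 => 0 | 2 => 1 | 3 => 0 | _ => 3)
    ⟨rfl, rfl, stratBy_pairMem rfl rfl, stratBy_pairMem rfl rfl, stratBy_pairMem rfl rfl⟩ rfl
    (cons V (cons z fun _ => f)) fun g hg => ?_
  exact h g _ (pairMem_iff_of_isRel hg)

/-- In the mixed cases `f(x)` is both `z` and an element of `V`, contrary to `z ∉ V`. -/
theorem functionalOn_bypass (hf : Γ ⊢ᵢ functionalOn f X) (hz : Γ ⊢ᵢ neg (z ∈ᵢ V))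
    (hX : Γ ⊢ᵢ isAdjoin X V z)
    (hg : ∀ x y, Γ ⊢ᵢ iff (pairMem x y g)
      (x ∈ᵢ V ∧ᵢ y ∈ᵢ V ∧ᵢ (pairMem x y f ∨ᵢ (pairMem x z f ∧ᵢ pairMem z y f)))) :
    Γ ⊢ᵢ functionalOn g V := by
  have mem_X : ∀ t, Γ ⊢ᵢ iff (t ∈ᵢ X) (t ∈ᵢ V ∨ᵢ t =ᵢ z) := fun t => .allE t hX
  refine functionalOn_intro fun x y y' => imp_intro fun hx => imp_intro fun hy =>
    imp_intro fun hy' => imp_intro fun h => imp_intro fun h' => ?_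
  have zX := iff_mpr (mem_X z) (.orI₂ (.eqI z))
  have hxX := iff_mpr (mem_X x).up (.orI₁ hx)
  have hyX := iff_mpr (mem_X y).up (.orI₁ hy)
  have hyX' := iff_mpr (mem_X y').up (.orI₁ hy')
  refine or_elim (.andE₂ (.andE₂ (iff_mp (hg x y).up h.up))) (fun h₁ => ?_) fun h₁ => ?_ <;>
  refine or_elim (.andE₂ (.andE₂ (iff_mp (hg x y').up h'.up))) (fun h₂ => ?_) fun h₂ => ?_
  · exact functionalOn_elim hf.up hxX.up hyX.up hyX'.up h₁.up h₂
  · exact .botE (.impE hz.up (mem_of_eq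
      (functionalOn_elim hf.up hxX.up hyX.up zX.up h₁.up (.andE₁ h₂)) hy.up))
  · exact .botE (.impE hz.up (mem_of_eq
      (functionalOn_elim hf.up hxX.up hyX'.up zX.up h₂ h₁.andE₁.up) hy'.up))
  · exact functionalOn_elim hf.up zX.up hyX.up hyX'.up h₁.andE₂.up h₂.andE₂

theorem onto_bypass (hf : Γ ⊢ᵢ functionalOn f X) (ho : Γ ⊢ᵢ onto f X X) (hz : Γ ⊢ᵢ neg (z ∈ᵢ V))
    (hX : Γ ⊢ᵢ isAdjoin X V z)
    (hg : ∀ x y, Γ ⊢ᵢ iff (pairMem x y g)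
      (x ∈ᵢ V ∧ᵢ y ∈ᵢ V ∧ᵢ (pairMem x y f ∨ᵢ (pairMem x z f ∧ᵢ pairMem z y f)))) :
    Γ ⊢ᵢ onto g V V := by
  have mem_X : ∀ t, Γ ⊢ᵢ iff (t ∈ᵢ X) (t ∈ᵢ V ∨ᵢ t =ᵢ z) := fun t => .allE t hX
  have zX := iff_mpr (mem_X z) (.orI₂ (.eqI z))
  refine onto_intro fun y => imp_intro fun hy => ?_
  have hyX := iff_mpr (mem_X y).up (.orI₁ hy)
  refine onto_elim ho.up hyX fun x hx h => ?_
  refine or_elim (iff_mp (mem_X x).up hx) (fun hx => ?_) fun hx => ?_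
  · exact .exI x (.andI hx (iff_mpr (hg x y).up (.andI hx (.andI hy.up (.orI₁ h.up)))))
  -- Here `f(z) = y`, so a preimage `w` of `z` is sent to `y` by `g`, unless `w = z`; but then `y =
  -- f(z) = z`, although `y ∈ V`.
  · have h₁ := pairMem_of_eq_left hx h.up
    refine onto_elim ho.up zX.up fun w hw h' => ?_
    refine or_elim (iff_mp (mem_X w).up hw) (fun hw => ?_) fun hw => ?_
    · exact .exI w (.andI hw (iff_mpr (hg w y).up
        (.andI hw (.andI hy.up (.orI₂ (.andI h'.up h₁.up))))))
    · exact .botE (.impE hz.up (mem_of_eq (functionalOn_elim hf.up zX.up hyX.up zX.up h₁.up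
        (pairMem_of_eq_left hw h'.up)) hy.up))

/-- If some element of `V` is sent to `z`, then `z` is sent to an element of `V`. -/
theorem value_at_adjoined (hf : Γ ⊢ᵢ functionalOn f X) (ht : Γ ⊢ᵢ totalOn g V)
    (hz : Γ ⊢ᵢ neg (z ∈ᵢ V)) (hX : Γ ⊢ᵢ isAdjoin X V z)
    (hg : ∀ x y, Γ ⊢ᵢ iff (pairMem x y g)
      (x ∈ᵢ V ∧ᵢ y ∈ᵢ V ∧ᵢ (pairMem x y f ∨ᵢ (pairMem x z f ∧ᵢ pairMem z y f))))
    {x : ℕ} (hx : Γ ⊢ᵢ x ∈ᵢ V) (h : Γ ⊢ᵢ pairMem x z f) :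
    Γ ⊢ᵢ ∃ᵢ (0 ∈ᵢ (V + 1) ∧ᵢ pairMem (z + 1) 0 (f + 1)) := by
  have mem_X : ∀ t, Γ ⊢ᵢ iff (t ∈ᵢ X) (t ∈ᵢ V ∨ᵢ t =ᵢ z) := fun t => .allE t hX
  refine totalOn_elim ht hx fun y hy h' => ?_
  refine or_elim (.andE₂ (.andE₂ (iff_mp (hg x y).up h'))) (fun h₁ => ?_) fun h₁ => ?_
  · exact .botE (.impE hz.up (mem_of_eq (functionalOn_elim hf.up (iff_mpr (mem_X x) (.orI₁ hx)).up
      (iff_mpr (mem_X y).up (.orI₁ hy)).up (iff_mpr (mem_X z) (.orI₂ (.eqI z))).up h₁ h.up) hy.up))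
  · exact .exI y (.andI hy.up (.andE₂ h₁))

theorem totalOn_of_bypass (hf : Γ ⊢ᵢ functionalOn f X) (ho : Γ ⊢ᵢ onto f X X)
    (ht : Γ ⊢ᵢ totalOn g V) (hz : Γ ⊢ᵢ neg (z ∈ᵢ V)) (hX : Γ ⊢ᵢ isAdjoin X V z)
    (hg : ∀ x y, Γ ⊢ᵢ iff (pairMem x y g)
      (x ∈ᵢ V ∧ᵢ y ∈ᵢ V ∧ᵢ (pairMem x y f ∨ᵢ (pairMem x z f ∧ᵢ pairMem z y f)))) :
    Γ ⊢ᵢ totalOn f X := by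
  have mem_X : ∀ t, Γ ⊢ᵢ iff (t ∈ᵢ X) (t ∈ᵢ V ∨ᵢ t =ᵢ z) := fun t => .allE t hX
  have zX := iff_mpr (mem_X z) (.orI₂ (.eqI z))
  refine totalOn_intro fun x => imp_intro fun hx => or_elim (iff_mp (mem_X x).up hx)
    (fun hx => ?_) fun hx => ?_
  · refine totalOn_elim ht.up hx fun y hy h => ?_
    refine or_elim (.andE₂ (.andE₂ (iff_mp (hg x y).up h))) (fun h₁ => ?_) fun h₁ => ?_
    · exact .exI y (.andI (iff_mpr (mem_X y).up (.orI₁ hy)).up h₁)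
    · exact .exI z (.andI zX.up (.andE₁ h₁))
  -- To find a value at `z`, take `w` with `f(w) = z`: either `w ∈ V` and `value_at_adjoined`
  -- applies, or `w = z` and `z` is its own value.
  · refine onto_elim ho.up zX.up fun w hw h => ?_
    refine or_elim (iff_mp (mem_X w).up hw) (fun hw => ?_) fun hw => ?_
    · refine ex_elim (value_at_adjoined hf.up ht.up hz.up hX.up (fun x y => (hg x y).up) hw h.up)
        fun y hy => ?_
      exact .exI y (.andI (iff_mpr (mem_X y).up (.orI₁ (.andE₁ hy)))
        (pairMem_of_eq_left (eq_symm hx).up (.andE₂ hy)))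
    · exact .exI z (.andI zX.up
        (pairMem_of_eq_left (eq_trans hw (eq_symm hx).up) h.up))

/-- No element of `V` has the same value as `z`. -/
theorem value_ne_of_bypass (hf : Γ ⊢ᵢ functionalOn f X) (ho : Γ ⊢ᵢ onto f X X)
    (hi : Γ ⊢ᵢ injectiveOn g V) (ht : Γ ⊢ᵢ totalOn g V) (hz : Γ ⊢ᵢ neg (z ∈ᵢ V))
    (hX : Γ ⊢ᵢ isAdjoin X V z)
    (hg : ∀ x y, Γ ⊢ᵢ iff (pairMem x y g)
      (x ∈ᵢ V ∧ᵢ y ∈ᵢ V ∧ᵢ (pairMem x y f ∨ᵢ (pairMem x z f ∧ᵢ pairMem z y f))))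
    {x y : ℕ} (hx : Γ ⊢ᵢ x ∈ᵢ V) (hy : Γ ⊢ᵢ y ∈ᵢ X) (h : Γ ⊢ᵢ pairMem x y f)
    (h' : Γ ⊢ᵢ pairMem z y f) : Γ ⊢ᵢ bot := by
  have mem_X : ∀ t, Γ ⊢ᵢ iff (t ∈ᵢ X) (t ∈ᵢ V ∨ᵢ t =ᵢ z) := fun t => .allE t hX
  have zX := iff_mpr (mem_X z) (.orI₂ (.eqI z))
  have xX := iff_mpr (mem_X x) (.orI₁ hx)
  refine or_elim (iff_mp (mem_X y) hy) (fun hyV => ?_) fun hyz => ?_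
  -- Let `f(w) = z`. If `w ∈ V`, then `g(w) = f(z) = y = g(x)`, so `w = x` and `y = z`; if `w = z`,
  -- again `y = f(z) = z`.
  · refine onto_elim ho.up zX.up fun w hw hwz => ?_
    refine or_elim (iff_mp (mem_X w).up hw) (fun hw => ?_) fun hw => ?_
    · have hwx := injectiveOn_elim hi.up hw hx.up hyV.up
        (iff_mpr (hg w y).up (.andI hw (.andI hyV.up (.orI₂ (.andI hwz.up h'.up)))))
        (iff_mpr (hg x y).up (.andI hx.up (.andI hyV.up (.orI₁ h.up))))
      exact .impE hz.up (mem_of_eq (functionalOn_elim hf.up xX.up hy.up zX.up h.up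
        (pairMem_of_eq_left hwx hwz.up)) hyV.up)
    · exact .impE hz.up (mem_of_eq (functionalOn_elim hf.up zX.up hy.up zX.up h'.up
        (pairMem_of_eq_left hw hwz.up)) hyV.up)
  -- Now `f(x) = z`, so `f(z)` lies in `V`, yet `f(z) = y = z`.
  · refine ex_elim (value_at_adjoined hf.up ht.up hz.up hX.up (fun x y => (hg x y).up) hx.up
      (pairMem_of_eq_right hyz h.up)) fun y' hy' => ?_
    have hyV := hy'.andE₁
    exact .impE hz.up (mem_of_eq (functionalOn_elim hf.up zX.up
      (iff_mpr (mem_X y').up (.orI₁ (.andE₁ hy'))) zX.up (.andE₂ hy')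
      (pairMem_of_eq_right hyz.up h'.up)) hyV)

theorem injectiveOn_of_bypass (hf : Γ ⊢ᵢ functionalOn f X) (ho : Γ ⊢ᵢ onto f X X)
    (hi : Γ ⊢ᵢ injectiveOn g V) (ht : Γ ⊢ᵢ totalOn g V) (hz : Γ ⊢ᵢ neg (z ∈ᵢ V))
    (hX : Γ ⊢ᵢ isAdjoin X V z)
    (hg : ∀ x y, Γ ⊢ᵢ iff (pairMem x y g)
      (x ∈ᵢ V ∧ᵢ y ∈ᵢ V ∧ᵢ (pairMem x y f ∨ᵢ (pairMem x z f ∧ᵢ pairMem z y f)))) :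
    Γ ⊢ᵢ injectiveOn f X := by
  have mem_X : ∀ t, Γ ⊢ᵢ iff (t ∈ᵢ X) (t ∈ᵢ V ∨ᵢ t =ᵢ z) := fun t => .allE t hX
  refine injectiveOn_intro fun x u y => imp_intro fun hx => imp_intro fun hu =>
    imp_intro fun hy => imp_intro fun h => imp_intro fun h' => ?_
  refine or_elim (iff_mp (mem_X x).up hx.up) (fun hx => ?_) fun hx => ?_ <;>
  refine or_elim (iff_mp (mem_X u).up hu.up) (fun hu => ?_) fun hu => ?_
  · refine or_elim (iff_mp (mem_X y).up hy.up) (fun hy => ?_) fun hy => ?_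
    · exact injectiveOn_elim hi.up hx.up hu.up hy
        (iff_mpr (hg x y).up (.andI hx.up (.andI hy (.orI₁ h.up))))
        (iff_mpr (hg u y).up (.andI hu.up (.andI hy (.orI₁ h'.up))))
    -- Both points are sent to `z` by `f`, hence to the common value `f(z)` by `g`.
    · have hxz := pairMem_of_eq_right hy h.up
      have huz := pairMem_of_eq_right hy h'.up
      refine ex_elim (value_at_adjoined hf.up ht.up hz.up hX.up (fun x y => (hg x y).up) hx.up hxz)
        fun y' hy' => ?_
      have hyV : _ ⊢ᵢ y' ∈ᵢ V := .andE₁ hy'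
      have hzy : _ ⊢ᵢ pairMem z y' f := .andE₂ hy'
      exact injectiveOn_elim hi.up hx.up hu.up hyV
        (iff_mpr (hg x y').up (.andI hx.up (.andI hyV (.orI₂ (.andI hxz.up hzy)))))
        (iff_mpr (hg u y').up (.andI hu.up (.andI hyV (.orI₂ (.andI huz.up hzy)))))
  · exact .botE (value_ne_of_bypass hf.up ho.up hi.up ht.up hz.up hX.up (fun x y => (hg x y).up)
      hx.up hy.up h.up (pairMem_of_eq_left hu h'.up))
  · exact .botE (value_ne_of_bypass hf.up ho.up hi.up ht.up hz.up hX.up (fun x y => (hg x y).up)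
      hu hy.up h'.up (pairMem_of_eq_left hx.up h.up))
  · exact eq_trans hx.up (eq_symm hu)

theorem pigeonhole_adjoin (hV : Γ ⊢ᵢ pigeonhole V) (hz : Γ ⊢ᵢ neg (z ∈ᵢ V))
    (hX : Γ ⊢ᵢ isAdjoin X V z) : Γ ⊢ᵢ pigeonhole X := by
  refine all_intro fun f => ?_
  change Γ ⊢ᵢ functionalOn f X →ᵢ onto f X X →ᵢ injectiveOn f X ∧ᵢ totalOn f X
  refine imp_intro fun hf => imp_intro fun ho => ?_
  replace hf : onto f X X :: functionalOn f X :: Γ ⊢ᵢ functionalOn f X := hf.up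
  refine bypass_elim V z f fun g A hg => ?_
  have hit := pigeonhole_elim hV.up (functionalOn_bypass hf.up hz.up hX.up hg)
    (onto_bypass hf.up ho.up hz.up hX.up hg)
  exact .andI
    (injectiveOn_of_bypass hf.up ho.up (.andE₁ hit) (.andE₂ hit) hz.up hX.up hg)
    (totalOn_of_bypass hf.up ho.up (.andE₂ hit) hz.up hX.up hg)

/-! ### Finite sets -/

/-- With `X` at index `1`, its elements are at `0` and the quantified relation at `3`. -/
theorem stratified_pigeonhole : Stratified (pigeonhole 0) := by
  refine ⟨fun _ => 1, 3, ?_, ?_, ?_, ?_⟩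
  · exact ⟨0, 0, 0, rfl, rfl, rfl, stratBy_pairMem rfl rfl, stratBy_pairMem rfl rfl, rfl⟩
  · exact ⟨0, rfl, 0, rfl, stratBy_pairMem rfl rfl⟩
  · exact ⟨0, 0, 0, rfl, rfl, rfl, stratBy_pairMem rfl rfl, stratBy_pairMem rfl rfl, rfl⟩
  · exact ⟨0, rfl, 0, rfl, stratBy_pairMem rfl rfl⟩

theorem exists_adjoin {χ : Fml} (V z : ℕ)
    (h : ∀ X, isAdjoin X V z :: Γ ⊢ᵢ isAdjoin X V z → isAdjoin X V z :: Γ ⊢ᵢ χ) : Γ ⊢ᵢ χ :=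
  comp_elim (φ := 0 ∈ᵢ 1 ∨ᵢ 0 =ᵢ 2) ⟨cons 0 (cons 1 fun _ => 0), rfl, rfl⟩ (cons V fun _ => z) h

theorem exists_empty {χ : Fml} (h : ∀ e, Γ ⊢ᵢ isEmpty e →ᵢ χ) : Γ ⊢ᵢ χ := by
  refine comp_elim (φ := bot) ⟨fun _ => 0, trivial⟩ id fun e he => .impE (h e).up ?_
  exact all_intro fun t => (mem_iff_of_isComp he t).andE₁

/-- The set `W` of all sets with the pigeonhole property is one of those over which finiteness
quantifies. -/
theorem pigeonhole_of_finite (h : Γ ⊢ᵢ finite X) : Γ ⊢ᵢ pigeonhole X := by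
  refine comp_elim stratified_pigeonhole id fun W hW => ?_
  have mem_W : ∀ t, _ ⊢ᵢ iff (t ∈ᵢ W) (pigeonhole t) := fun t => mem_iff_of_isComp hW t
  refine iff_mp (mem_W X) ?_
  have hX : Γ ⊢ᵢ finClosed W →ᵢ X ∈ᵢ W := .allE W h
  refine .impE hX.up (.andI ?_ ?_)
  · exact exists_empty fun e => imp_intro fun he =>
      .exI e (.andI he (iff_mpr (mem_W e).up (pigeonhole_of_isEmpty he)))
  · refine all_intro fun u => all_intro fun z => ?_
    change _ ⊢ᵢ u ∈ᵢ W ∧ᵢ neg (z ∈ᵢ u) →ᵢ ∃ᵢ (isAdjoin 0 (u + 1) (z + 1) ∧ᵢ 0 ∈ᵢ (W + 1))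
    refine imp_intro fun huz => exists_adjoin u z fun v hv => .exI v (.andI hv ?_)
    exact iff_mpr (mem_W v).up
      (pigeonhole_adjoin (iff_mp (mem_W u).up huz.andE₁.up) huz.andE₂.up hv)

end

/-! ### Maps -/

section
variable {Γ : List Fml} {f g h X Y a b : ℕ}

theorem maps_elim (hf : Γ ⊢ᵢ maps f X Y) {x : ℕ} (hx : Γ ⊢ᵢ x ∈ᵢ X) :
    Γ ⊢ᵢ ∃ᵢ (0 ∈ᵢ (Y + 1) ∧ᵢ pairMem (x + 1) 0 (f + 1) ∧ᵢ
      ∀ᵢ (pairMem (x + 2) 0 (f + 2) →ᵢ 0 =ᵢ 1)) := by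
  have : Γ ⊢ᵢ x ∈ᵢ X →ᵢ ∃ᵢ (0 ∈ᵢ (Y + 1) ∧ᵢ pairMem (x + 1) 0 (f + 1) ∧ᵢ
      ∀ᵢ (pairMem (x + 2) 0 (f + 2) →ᵢ 0 =ᵢ 1)) := .allE x hf
  exact .impE this hx

theorem exists_of_maps (hf : Γ ⊢ᵢ maps f X Y) {x : ℕ} (hx : Γ ⊢ᵢ x ∈ᵢ X) {χ : Fml}
    (k : ∀ (y : ℕ) (A : Fml), A :: Γ ⊢ᵢ y ∈ᵢ Y → A :: Γ ⊢ᵢ pairMem x y f → A :: Γ ⊢ᵢ χ) :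
    Γ ⊢ᵢ χ :=
  ex_elim (maps_elim hf hx) fun y hy => k y _ (.andE₁ hy) (.andE₁ (.andE₂ hy))

theorem eq_of_maps (hf : Γ ⊢ᵢ maps f X Y) {x y y' : ℕ} (hx : Γ ⊢ᵢ x ∈ᵢ X)
    (h : Γ ⊢ᵢ pairMem x y f) (h' : Γ ⊢ᵢ pairMem x y' f) : Γ ⊢ᵢ y =ᵢ y' := by
  refine ex_elim (maps_elim hf hx) fun w hw => ?_
  have hu : ∀ t, _ ⊢ᵢ pairMem x t f →ᵢ t =ᵢ w := fun t => .allE t (.andE₂ (.andE₂ hw))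
  exact eq_trans (.impE (hu y) h.up) (eq_symm (.impE (hu y') h'.up))

theorem mem_of_maps (hf : Γ ⊢ᵢ maps f X Y) {x y : ℕ} (hx : Γ ⊢ᵢ x ∈ᵢ X)
    (h : Γ ⊢ᵢ pairMem x y f) : Γ ⊢ᵢ y ∈ᵢ Y :=
  exists_of_maps hf hx fun _ _ hy' h' => mem_of_eq (eq_of_maps hf.up hx.up h' h.up) hy'

theorem eq_of_oneOne (hf : Γ ⊢ᵢ oneOne f X Y) {x u y : ℕ} (h : Γ ⊢ᵢ pairMem x y f)
    (h' : Γ ⊢ᵢ pairMem u y f) : Γ ⊢ᵢ x =ᵢ u := by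
  have : Γ ⊢ᵢ pairMem x y f ∧ᵢ pairMem u y f →ᵢ x =ᵢ u :=
    .allE y (.allE u (.allE x (.andE₁ (.andE₂ hf))))
  exact .impE this (.andI h h')

theorem mem_of_domSubset (hd : Γ ⊢ᵢ domSubset f X) {x y : ℕ} (h : Γ ⊢ᵢ pairMem x y f) :
    Γ ⊢ᵢ x ∈ᵢ X := by
  have : Γ ⊢ᵢ pairMem x y f →ᵢ x ∈ᵢ X := .allE y (.allE x hd)
  exact .impE this h

/-- Being a map on `X` does not restrict pairs with first component outside `X`; the domain
condition does, and gives the last clause. -/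
theorem oneOne_intro (hf : Γ ⊢ᵢ maps f X Y) (hd : Γ ⊢ᵢ domSubset f X)
    (hi : ∀ x u y, Γ ⊢ᵢ pairMem x y f ∧ᵢ pairMem u y f →ᵢ x =ᵢ u) : Γ ⊢ᵢ oneOne f X Y := by
  refine .andI hf (.andI ?_ ?_)
  · exact all_intro fun x => all_intro fun u => all_intro fun y => hi x u y
  · refine all_intro fun x => all_intro fun y => ?_
    change Γ ⊢ᵢ y ∈ᵢ Y ∧ᵢ pairMem x y f →ᵢ x ∈ᵢ X
    exact imp_intro fun h => mem_of_domSubset hd.up (.andE₂ h)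

theorem oneOne_of_onto (hX : Γ ⊢ᵢ finite X) (hf : Γ ⊢ᵢ maps f X X) (ho : Γ ⊢ᵢ onto f X X)
    (hd : Γ ⊢ᵢ domSubset f X) : Γ ⊢ᵢ oneOne f X X := by
  have hi : Γ ⊢ᵢ injectiveOn f X :=
    (pigeonhole_elim (pigeonhole_of_finite hX)
      (functionalOn_intro fun x y y' => imp_intro fun hx => imp_intro fun _ => imp_intro fun _ =>
        imp_intro fun h => imp_intro fun h' => eq_of_maps hf.up hx.up h.up h') ho).andE₁
  refine oneOne_intro hf hd fun x u y => imp_intro fun h => ?_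
  have hx := mem_of_domSubset hd.up (Proves.andE₁ h)
  exact injectiveOn_elim hi.up hx (mem_of_domSubset hd.up (.andE₂ h))
    (mem_of_maps hf.up hx (.andE₁ h)) (.andE₁ h) (.andE₂ h)

/-- `f ∘ g ∘ h⁻¹` as a partial function: the variables of
`∃ t, t ∈ a ∧ h(t) = y ∧ ∃ x ∈ X, g(t) = x ∧ f(x) = y'` are `y = 0`, `y' = 1`, `a = 2`, `X = 3`,
`f = 4`, `g = 5`, `h = 6`. -/
def conjugate : Fml :=
  ∃ᵢ (0 ∈ᵢ 3 ∧ᵢ pairMem 0 1 7 ∧ᵢ ∃ᵢ (0 ∈ᵢ 5 ∧ᵢ pairMem 1 0 7 ∧ᵢ pairMem 0 3 6))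

theorem exists_conjugate {χ : Fml} (a X f g h : ℕ)
    (k : ∀ (F : ℕ) (A : Fml), (∀ y y', A :: Γ ⊢ᵢ iff (pairMem y y' F)
      (∃ᵢ (0 ∈ᵢ (a + 1) ∧ᵢ pairMem 0 (y + 1) (h + 1) ∧ᵢ
        ∃ᵢ (0 ∈ᵢ (X + 2) ∧ᵢ pairMem 1 0 (g + 2) ∧ᵢ pairMem 0 (y' + 2) (f + 2))))) → A :: Γ ⊢ᵢ χ) :
    Γ ⊢ᵢ χ := by
  refine rel_elim (φ := conjugate)
    (σ := fun | 0 => 0 | 1 => 0 | 2 => 1 | 3 => 1 | _ => 3)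
    ⟨0, rfl, stratBy_pairMem rfl rfl, 0, rfl, stratBy_pairMem rfl rfl, stratBy_pairMem rfl rfl⟩ rfl
    (cons a (cons X (cons f (cons g fun _ => h)))) fun F hF => ?_
  exact k F _ (pairMem_iff_of_isRel hF)

theorem oneOne_of_embedding (hY : Γ ⊢ᵢ finite Y) (hg : Γ ⊢ᵢ maps g a X) (hgo : Γ ⊢ᵢ onto g a X)
    (hh : Γ ⊢ᵢ oneOne h b Y) (hab : Γ ⊢ᵢ subset a b) (hf : Γ ⊢ᵢ maps f X Y)
    (ho : Γ ⊢ᵢ onto f X Y) (hd : Γ ⊢ᵢ domSubset f X) : Γ ⊢ᵢ oneOne f X Y := by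
  have sub : ∀ t, Γ ⊢ᵢ t ∈ᵢ a →ᵢ t ∈ᵢ b := fun t => .allE t hab
  refine exists_conjugate a X f g h fun F A hF => ?_
  have F_intro : ∀ {Δ : List Fml} [Sub (A :: Γ) Δ] {t x y y' : ℕ}, Δ ⊢ᵢ t ∈ᵢ a →
      Δ ⊢ᵢ pairMem t y h → Δ ⊢ᵢ x ∈ᵢ X → Δ ⊢ᵢ pairMem t x g → Δ ⊢ᵢ pairMem x y' f →
      Δ ⊢ᵢ pairMem y y' F := fun {Δ} _ {t x y y'} ht hty hx htx hxy =>
    iff_mpr (hF y y').up (.exI t (.andI ht (.andI hty (.exI x (.andI hx (.andI htx hxy))))))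
  have F_elim : ∀ {Δ : List Fml} [Sub (A :: Γ) Δ] {y y' : ℕ} {χ : Fml}, Δ ⊢ᵢ pairMem y y' F →
      (∀ (t x : ℕ) (B C : Fml), B :: C :: Δ ⊢ᵢ t ∈ᵢ a → B :: C :: Δ ⊢ᵢ pairMem t y h →
        B :: C :: Δ ⊢ᵢ x ∈ᵢ X → B :: C :: Δ ⊢ᵢ pairMem t x g → B :: C :: Δ ⊢ᵢ pairMem x y' f →
        B :: C :: Δ ⊢ᵢ χ) → Δ ⊢ᵢ χ := by
    intro Δ _ y y' χ hyy k
    refine ex_elim (iff_mp (hF y y').up hyy) fun t ht => ?_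
    have ht₁ : _ ⊢ᵢ t ∈ᵢ a := .andE₁ ht
    have ht₂ : _ ⊢ᵢ pairMem t y h := .andE₁ (.andE₂ ht)
    refine ex_elim (.andE₂ (.andE₂ ht)) fun x hx => ?_
    exact k t x _ _ ht₁.up ht₂.up (.andE₁ hx) (.andE₁ (.andE₂ hx)) (.andE₂ (.andE₂ hx))
  have hFf : A :: Γ ⊢ᵢ functionalOn F Y := by
    refine functionalOn_intro fun y z z' => imp_intro fun _ => imp_intro fun _ =>
      imp_intro fun _ => imp_intro fun hz => imp_intro fun hz' => ?_
    refine F_elim hz.up fun t x B C ht hty hx htx hxz => ?_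
    -- The point `t` is determined by `y` since `h` is one-to-one; then `g` determines `x` and `f`
    -- the value.
    refine F_elim hz'.up fun t' x' B' C' ht' hty' hx' htx' hxz' => ?_
    have htt := eq_of_oneOne hh.up hty' hty.up
    have hxx := eq_of_maps hg.up ht.up (pairMem_of_eq_left htt htx') htx.up
    exact eq_of_maps hf.up hx.up hxz.up (pairMem_of_eq_left hxx hxz')
  have hFo : A :: Γ ⊢ᵢ onto F Y Y := by
    refine onto_intro fun y' => imp_intro fun hy' => ?_
    -- Go back from `y'` to `x` along `f` and to `t` along `g`, then forward to `y = h(t)`, which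
    -- exists because `a ⊆ b`.
    refine onto_elim ho.up hy' fun x hx hxy => onto_elim hgo.up hx fun t ht htx => ?_
    refine exists_of_maps hh.andE₁.up (.impE (sub t).up ht) fun y B hy hty => ?_
    exact .exI y (.andI hy (F_intro ht.up hty hx.up htx.up hxy.up))
  have hFi := (pigeonhole_elim (pigeonhole_of_finite hY.up) hFf hFo).andE₁
  refine oneOne_intro hf.up hd.up fun x u y => imp_intro fun hxu => ?_
  have hx := mem_of_domSubset hd.up (Proves.andE₁ hxu)
  have hu := mem_of_domSubset hd.up (Proves.andE₂ hxu)
  have hy := mem_of_maps hf.up hx (Proves.andE₁ hxu)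
  -- Write `x = g(t)` and `u = g(s)`. Then `F` sends `h(t)` and `h(s)` to the same `y`, so `h(t) =
  -- h(s)`, `t = s` and `x = u`.
  refine onto_elim hgo.up hx fun t ht htx => onto_elim hgo.up hu.up fun s hs hsu => ?_
  refine exists_of_maps hh.andE₁.up (.impE (sub t).up ht.up) fun v B hv htv => ?_
  refine exists_of_maps hh.andE₁.up (.impE (sub s).up hs.up) fun w C hw hsw => ?_
  have hvw := injectiveOn_elim hFi.up hv.up hw hy.up
    (F_intro ht.up htv.up hx.up htx.up hxu.andE₁.up) (F_intro hs.up hsw hu.up hsu.up hxu.andE₂.up)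
  have hts := eq_of_oneOne hh.up (pairMem_of_eq_right hvw htv.up) hsw
  exact eq_of_maps hg.up hs.up (pairMem_of_eq_left hts htx.up) hsu.up

theorem oneOne_of_onto_of_ncLe (hY : Γ ⊢ᵢ finite Y) (hle : Γ ⊢ᵢ NcLe X Y) (hf : Γ ⊢ᵢ maps f X Y)
    (ho : Γ ⊢ᵢ onto f X Y) (hd : Γ ⊢ᵢ domSubset f X) : Γ ⊢ᵢ oneOne f X Y := by
  refine ex_elim hle fun κ hκ => ex_elim hκ fun μ hμ => ?_
  have hκX : ∀ t, _ ⊢ᵢ iff (t ∈ᵢ κ) (similar t X) := fun t => .allE t (.andE₁ hμ)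
  have hμY : ∀ t, _ ⊢ᵢ iff (t ∈ᵢ μ) (similar t Y) := fun t => .allE t (.andE₁ (.andE₂ hμ))
  refine ex_elim (.andE₂ (.andE₂ hμ)) fun a ha => ex_elim ha fun b hb => ?_
  have haκ : _ ⊢ᵢ a ∈ᵢ κ := .andE₁ hb
  have hbμ : _ ⊢ᵢ b ∈ᵢ μ := .andE₁ (.andE₂ hb)
  have hab : _ ⊢ᵢ subset a b := .andE₁ (.andE₂ (.andE₂ hb))
  refine ex_elim (iff_mp (hκX a).up haκ) fun g hg => ?_
  have hg₁ : _ ⊢ᵢ maps g a X := .andE₁ hg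
  have hg₂ : _ ⊢ᵢ onto g a X := .andE₂ (.andE₂ hg)
  refine ex_elim (iff_mp (hμY b).up hbμ.up) fun h hh => ?_
  have hh₁ : _ ⊢ᵢ oneOne h b Y := .andE₁ (.andE₂ hh)
  exact oneOne_of_embedding hY.up hg₁.up hg₂.up hh₁ hab.up hf.up ho.up hd.up

end

/-! ### The two closed theorems of INF -/

theorem provable_ontoImpliesOneOne : Provable ontoImpliesOneOne := by
  refine all_intro fun X => all_intro fun f => ?_
  change [] ⊢ᵢ finite X →ᵢ maps f X X →ᵢ onto f X X →ᵢ domSubset f X →ᵢ oneOne f X X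
  exact imp_intro fun hX => imp_intro fun hf => imp_intro fun ho => imp_intro fun hd =>
    oneOne_of_onto hX.up hf.up ho.up hd

theorem provable_ontoImpliesOneOneGeneral : Provable ontoImpliesOneOneGeneral := by
  refine all_intro fun X => all_intro fun Y => all_intro fun f => ?_
  change [] ⊢ᵢ finite X →ᵢ finite Y →ᵢ NcLe X Y →ᵢ maps f X Y →ᵢ onto f X Y →ᵢ
    domSubset f X →ᵢ oneOne f X Y
  exact imp_intro fun _ => imp_intro fun hY => imp_intro fun hle => imp_intro fun hf =>
    imp_intro fun ho => imp_intro fun hd => oneOne_of_onto_of_ncLe hY.up hle.up hf.up ho.up hd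

end INF

theorem mainTheorem10 :
    INF.Provable INF.ontoImpliesOneOne ∧ INF.Provable INF.ontoImpliesOneOneGeneral :=
  ⟨INF.provable_ontoImpliesOneOne, INF.provable_ontoImpliesOneOneGeneral⟩
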